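/- Let $\Sigma$ be a finite alphabet and $k\ge 1$. Let $\mathcal P(\Sigma^k)$ be the set of probability vectors indexed by $\Sigma^k$, with the $\ell_\infty$-norm, and let $\mathcal P_{\mathrm{si}}(\Sigma^k)$ be the set of shift-invariant ones, i.e. those $\eta$ with $\sum_{a}\eta(a\phi)=\sum_a\eta(\phi a)$ for all $\phi\in\Sigma^{k-1}$. For a word $\omega$ with $|\omega|\ge k$ let $\mathrm{fr}^k_\omega\in\mathcal P(\Sigma^k)$ be its empirical distribution of length-$k$ subwords. For $\Gamma\subseteq\mathcal P(\Sigma^k)$ put $\mathcal B(\Gamma)=\{\omega\in\Sigma^*: |\omega|\ge k,\ \mathrm{fr}^k_\omega\in\Gamma\}$, $\mathcal B_m(\Gamma)=\mathcal B(\Gamma)\cap\Sigma^m$ and $R_m(\Gamma)=\mathcal B_m(\Gamma)^*$ (all finite concatenations of words of $\mathcal B_m(\Gamma)$). The capacity of $S\subseteq\Sigma^*$ is $\mathrm{cap}(S)=\limsup_{n\to\infty}\frac1n\log_2|S\cap\Sigma^n|\in[-\infty,\infty]$, where $\log_2 0=-\infty$. Call $\Gamma$ fat if $\mathrm{cl}(\mathrm{int}(\Gamma\cap\mathcal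 P_{\mathrm{si}}))=\mathrm{cl}(\Gamma\cap\mathcal P_{\mathrm{si}})$, closure and interior being taken relative to $\mathcal P_{\mathrm{si}}=\mathcal P_{\mathrm{si}}(\Sigma^k)$. For $\varepsilon>0$ let $$\Gamma_\varepsilon=\Big\{\eta\in\mathcal P(\Sigma^k):\ \inf_{\mu\in\mathcal P(\Sigma^k)\setminus\Gamma}\|\eta-\mu\|_\infty>\varepsilon\Big\}\qquad(\inf\emptyset=+\infty),$$ and call $\varepsilon>0$ $\Gamma$-admissible if $\Gamma_\varepsilon$ is fat and $\Gamma_\varepsilon\cap\mathcal P_{\mathrm{si}}\ne\emptyset$. **Theorem.** Let $\Gamma\subseteq\mathcal P(\Sigma^k)$ be closed, convex and fat, and let $\varepsilon>0$ be $\Gamma$-admissible and such that $\Gamma_\varepsilon$ is convex. Then $\mathrm{cap}(R_m(\Gamma_\varepsilon))=\frac1m\log_2|\mathcal B_m(\Gamma_\varepsilon)|$ for every $m\ge1$, and the limit $\lim_{m\to\infty}\mathrm{cap}(R_m(\Gamma_\varepsilon))$ exists and $$\lim_{m\to\infty}\mathrm{cap}(R_m(\Gamma_\varepsilon))=\mathrm{cap}(\mathcal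 B(\Gamma_\varepsilon)).$$ -/

import Mathlib

open Filter Topology

namespace Semiconstrained

noncomputable section

/-- `𝒫(Σᵏ)`: probability vectors indexed by the words of length `k` over the alphabet `α`.
The ambient function space carries the sup norm. -/
def probMeasures (α : Type*) [Fintype α] [DecidableEq α] (k : ℕ) :
    Set ((Fin k → α) → ℝ) :=
  stdSimplex ℝ (Fin k → α)

/-- Shift-invariant probability vectors on words of length `r + 1`:
`∑ₐ η(aφ) = ∑ₐ η(φa)` for every word `φ` of length `r`. -/
def shiftInvariant (α : Type*) [Fintype α] [DecidableEq α] (r : ℕ) :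
    Set ((Fin (r + 1) → α) → ℝ) :=
  {η | η ∈ probMeasures α (r + 1) ∧ ∀ φ : Fin r → α,
    ∑ a : α, η (Fin.cons a φ : Fin (r + 1) → α) =
      ∑ a : α, η (Fin.snoc φ a : Fin (r + 1) → α)}

/-- Empirical frequency of the word `β` of length `k` in `w`: the number of factorizations
`w = uβv` divided by `|w| - k + 1`. It is used only when `k ≤ |w|`. -/
def freq {α : Type*} (k : ℕ) (w : List α) (β : Fin k → α) : ℝ :=
  ({p : List α × List α | p.1 ++ List.ofFn β ++ p.2 = w}.ncard : ℝ) /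
    ((w.length : ℝ) - (k : ℝ) + 1)

/-- The admissible words `ℬ(Γ)`. -/
def admissibleWords {α : Type*} {k : ℕ} (Γ : Set ((Fin k → α) → ℝ)) : Language α :=
  {w | k ≤ w.length ∧ freq k w ∈ Γ}

/-- The words of `S` of length exactly `n`, that is `S ∩ Σⁿ`. -/
def wordsOfLength {α : Type*} (S : Language α) (n : ℕ) : Language α :=
  {w | w ∈ S ∧ w.length = n}

/-- The base-two logarithm of a natural number, with `log₂ 0 = -∞`. -/
def log2 (N : ℕ) : EReal :=
  if N = 0 then ⊥ else ((Real.logb 2 (N : ℝ) : ℝ) : EReal)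

/-- `(1 / n) log₂ |S ∩ Σⁿ|`, an extended real number. -/
def growth {α : Type*} (S : Language α) (n : ℕ) : EReal :=
  ((1 / (n : ℝ) : ℝ) : EReal) * log2 (Set.ncard (wordsOfLength S n : Set (List α)))

/-- The capacity of a set of words. -/
def capacity {α : Type*} (S : Language α) : EReal :=
  limsup (fun n : ℕ => growth S n) atTop

/-- `Γ` is fat: `cl (int (Γ ∩ 𝒫si)) = cl (Γ ∩ 𝒫si)`, where interior and closure are taken in the
space `𝒫si` of shift-invariant probability vectors. -/
def IsFat {α : Type*} [Fintype α] [DecidableEq α] {r : ℕ}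
    (Γ : Set ((Fin (r + 1) → α) → ℝ)) : Prop :=
  closure (interior ((Subtype.val : shiftInvariant α r → _) ⁻¹' Γ)) =
    closure ((Subtype.val : shiftInvariant α r → _) ⁻¹' Γ)

/-- `Γ_ε`: the probability vectors whose sup-norm distance to the complement of `Γ` in `𝒫(Σᵏ)`
is larger than `ε`. The distance to the empty set is `∞`. -/
def shrink {α : Type*} [Fintype α] [DecidableEq α] {k : ℕ}
    (Γ : Set ((Fin k → α) → ℝ)) (ε : ℝ) : Set ((Fin k → α) → ℝ) :=
  {η | η ∈ probMeasures α k ∧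
    ENNReal.ofReal ε < Metric.infEDist η (probMeasures α k \ Γ)}

/-- `ε > 0` is `Γ`-admissible: `Γ_ε` is fat and does not degenerate, in that it contains a
shift-invariant probability vector. -/
def IsAdmissible {α : Type*} [Fintype α] [DecidableEq α] {r : ℕ}
    (Γ : Set ((Fin (r + 1) → α) → ℝ)) (ε : ℝ) : Prop :=
  0 < ε ∧ (shrink Γ ε ∩ shiftInvariant α r).Nonempty ∧ IsFat (shrink Γ ε)

/-- The block construction `R_m(Γ) = ℬ_m(Γ)*` (Kleene star). -/
def blockLanguage {α : Type*} {k : ℕ} (Γ : Set ((Fin k → α) → ℝ)) (m : ℕ) : Language α :=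
  KStar.kstar (wordsOfLength (admissibleWords Γ) m)

end

end Semiconstrained

/-! Write `G` for `shrink Γ ε`. Words of equal length concatenate uniquely, so the block language
has exactly `N ^ t` words of length `t * m`, with `N` the number of blocks: its capacity is the
growth of `admissibleWords G` at `m`. It remains to show that the limsup defining the capacity of
`admissibleWords G` is a limit.

Concatenated blocks may leave `G` because of the uncontrolled windows across junctions, `r` at each.
A suffix `v` of length about `δ * n` corrects this. It has frequencies close to a shift-invariant `η
∈ G` (`exists_word_of_shiftInvariant`, through a stationary Markov chain). The windows inside the
blocks average to a point of `G` by convexity. The remaining ones, in `v` and across junctions, have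
a distribution near `η` once `m` is large, hence in `G`, which is relatively open in the simplex.
The frequency vector of the whole word is a convex combination of the two
(`append_mem_admissibleWords`). As `v` may have any large length, a good rate at one large `m`
persists, up to a factor `1 - δ`, at every large `n` (`eventually_growth_ge`).

Only lower bounds on counts are needed: concatenation is superadditive, and total mass fixes the
rest. -/

namespace Semiconstrained

/-! ### Counting occurrences of a word -/

section Occurrences

variable {α : Type*}

/-- The number of occurrences of `β` in `w`. -/
noncomputable def occ {k : ℕ} (w : List α) (β : Fin k → α) : ℕ :=
  {p : List α × List α | p.1 ++ List.ofFn β ++ p.2 = w}.ncard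

lemma freq_eq_occ_div {k : ℕ} (w : List α) (β : Fin k → α) :
    freq k w β = (occ w β : ℝ) / ((w.length : ℝ) - (k : ℝ) + 1) := rfl

lemma finite_factorizations (b w : List α) :
    {p : List α × List α | p.1 ++ b ++ p.2 = w}.Finite := by
  refine ((List.finite_toSet w.inits).prod (List.finite_toSet w.tails)).subset ?_
  rintro ⟨u, v⟩ h
  have h : u ++ b ++ v = w := h
  simp only [Set.mem_prod, Set.mem_ofPred_eq, List.mem_inits, List.mem_tails]
  exact ⟨⟨b ++ v, by simpa using h⟩, ⟨u ++ b, h⟩⟩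

lemma occ_nil {r : ℕ} (β : Fin (r + 1) → α) : occ [] β = 0 := by
  have : {p : List α × List α | p.1 ++ List.ofFn β ++ p.2 = []} = ∅ := by
    ext p
    simp
  rw [occ, this, Set.ncard_empty]

lemma occ_cons {r : ℕ} (a : α) (w : List α) (β : Fin (r + 1) → α)
    [Decidable (List.ofFn β <+: a :: w)] :
    occ (a :: w) β = occ w β + if List.ofFn β <+: a :: w then 1 else 0 := by
  have hsplit : {p : List α × List α | p.1 ++ List.ofFn β ++ p.2 = a :: w} =
      (fun p : List α × List α => (a :: p.1, p.2)) ''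
          {p : List α × List α | p.1 ++ List.ofFn β ++ p.2 = w} ∪
        {p : List α × List α | p.1 = [] ∧ List.ofFn β ++ p.2 = a :: w} := by
    ext ⟨u, v⟩
    cases u with
    | nil => simp
    | cons b u => simp [and_comm, eq_comm]
  have hfin := finite_factorizations (List.ofFn β) w
  have hfin' : {p : List α × List α | p.1 = [] ∧ List.ofFn β ++ p.2 = a :: w}.Finite := by
    refine (finite_factorizations (List.ofFn β) (a :: w)).subset ?_
    rintro ⟨u, v⟩ ⟨rfl, h⟩
    simpa using h
  rw [occ, hsplit, Set.ncard_union_eq _ (hfin.image _) hfin', Set.ncard_image_of_injective]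
  · congr 1
    split_ifs with h
    · obtain ⟨v, hv⟩ := h
      rw [Set.ncard_eq_one]
      refine ⟨([], v), ?_⟩
      ext ⟨x, y⟩
      simp only [Set.mem_ofPred_eq, Set.mem_singleton_iff, Prod.mk.injEq, ← hv,
        List.append_cancel_left_eq]
    · rw [Set.ncard_eq_zero hfin']
      ext ⟨x, y⟩
      simp only [Set.mem_ofPred_eq, Set.mem_empty_iff_false, iff_false, not_and]
      exact fun _ hy => h ⟨y, hy⟩
  · rintro ⟨u, v⟩ ⟨u', v'⟩ h
    simpa using h
  · rw [Set.disjoint_left]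
    rintro _ ⟨p, -, rfl⟩ h
    simp at h

/-- Occurrences across the junction can only add to the count. -/
lemma occ_add_le_occ_append {r : ℕ} (u v : List α) (β : Fin (r + 1) → α) :
    occ u β + occ v β ≤ occ (u ++ v) β := by
  classical
  induction u with
  | nil => simp [occ_nil]
  | cons a u ih =>
    rw [List.cons_append, occ_cons, occ_cons]
    have : (if List.ofFn β <+: a :: u then 1 else 0) ≤
        if List.ofFn β <+: a :: (u ++ v) then 1 else 0 := by
      split_ifs with h h'
      · exact le_rfl
      · exact absurd (h.trans (List.prefix_append (a :: u) v)) h'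
      · simp
      · exact le_rfl
    omega

lemma ofFn_prefix_iff {k : ℕ} (β : Fin k → α) (w : List α) (h : k ≤ w.length) :
    List.ofFn β <+: w ↔ β = fun i => w.get (Fin.castLE h i) := by
  rw [List.prefix_iff_eq_take]
  constructor
  · intro e
    funext i
    have h1 : (List.ofFn β)[(i : ℕ)]'(by simp) = β i := by simp
    rw [← h1]
    simp only [List.get_eq_getElem, Fin.val_castLE]
    have := List.getElem_of_eq e (i := (i : ℕ)) (by simp)
    rw [this]
    simp
  · rintro rfl
    apply List.ext_getElem
    · simp [h]
    · intro i h1 h2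
      simp

/-- Each window of length `r + 1` is an occurrence of exactly one `β`; truncated subtraction covers
words too short to have a window. -/
lemma sum_occ [Fintype α] {r : ℕ} (w : List α) :
    ∑ β : Fin (r + 1) → α, occ w β = w.length - r := by
  classical
  induction w with
  | nil => simp [occ_nil]
  | cons a w ih =>
    simp only [occ_cons, Finset.sum_add_distrib, ih]
    by_cases h : r + 1 ≤ (a :: w).length
    · simp only [ofFn_prefix_iff _ _ h, Finset.sum_ite_eq', Finset.mem_univ, if_true]
      simp only [List.length_cons] at h ⊢
      omega
    · have : ∀ β : Fin (r + 1) → α, ¬ List.ofFn β <+: a :: w := fun β hβ =>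
        h (by simpa using hβ.length_le)
      simp only [this, if_false, Finset.sum_const_zero]
      simp only [List.length_cons] at h ⊢
      omega

lemma sum_cons [Fintype α] {M : Type*} [AddCommMonoid M] {n : ℕ} (f : (Fin (n + 1) → α) → M) :
    ∑ w, f w = ∑ a : α, ∑ w : Fin n → α, f (Fin.cons a w) := by
  rw [← (Fin.consEquiv fun _ : Fin (n + 1) => α).sum_comp f, Fintype.sum_prod_type]
  rfl

lemma sum_snoc [Fintype α] {M : Type*} [AddCommMonoid M] {n : ℕ} (f : (Fin (n + 1) → α) → M) :
    ∑ w, f w = ∑ a : α, ∑ w : Fin n → α, f (Fin.snoc w a) := by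
  rw [← (Fin.snocEquiv fun _ : Fin (n + 1) => α).sum_comp f, Fintype.sum_prod_type]
  rfl

lemma occ_ofFn_cons [DecidableEq α] {r n : ℕ} (a : α) (w : Fin (r + n) → α) (β : Fin (r + 1) → α) :
    occ (List.ofFn (Fin.cons a w : Fin (r + n + 1) → α)) β = occ (List.ofFn w) β +
      if (Fin.cons a (fun i => w (Fin.castAdd n i)) : Fin (r + 1) → α) = β then 1 else 0 := by
  have hlen : r + 1 ≤ (a :: List.ofFn w).length := by simp
  rw [List.ofFn_cons, occ_cons]
  congr 1
  refine if_congr ?_ rfl rfl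
  rw [ofFn_prefix_iff _ _ hlen, eq_comm]
  apply iff_of_eq
  congr 1
  funext i
  refine Fin.cases ?_ (fun j => ?_) i
  · simp
  · simp [Fin.castAdd]
    rfl

end Occurrences

/-! ### Stationary Markov weights realizing a shift-invariant vector -/

section StationaryWeights

variable {α : Type*} [Fintype α] [DecidableEq α]

/-- A shift-invariant `η` is, up to the factor `n`, the mean occurrence vector of the words of
length `r + n` under the weights of a stationary Markov chain of order `r`. -/
lemma exists_stationary_weights {r : ℕ} {η : (Fin (r + 1) → α) → ℝ}
    (hη : η ∈ shiftInvariant α r) (n : ℕ) :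
    ∃ μ : (Fin (r + n) → α) → ℝ, (∀ w, 0 ≤ μ w) ∧
      (∀ g : (Fin r → α) → ℝ, ∑ w, μ w * g (fun i => w (Fin.castAdd n i)) =
        ∑ φ, (∑ a, η (Fin.cons a φ : Fin (r + 1) → α)) * g φ) ∧
      ∀ β : Fin (r + 1) → α, ∑ w, μ w * occ (List.ofFn w) β = n * η β := by
  obtain ⟨⟨hnn, hsum⟩, hsi⟩ := hη
  have hne : Nonempty α := by
    by_contra h
    rw [not_nonempty_iff] at h
    simp at hsum
  set m : (Fin r → α) → ℝ := fun φ => ∑ a, η (Fin.cons a φ : Fin (r + 1) → α) with hm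
  have hmnn : ∀ φ, 0 ≤ m φ := fun φ => Finset.sum_nonneg fun a _ => hnn _
  -- `p a φ` is the probability of prepending `a` to a word starting with `φ`. Where `m φ = 0` the
  -- uniform law serves: `η` vanishes on every `aφ` there.
  obtain ⟨p, hpnn, hpsum, hpη⟩ : ∃ p : α → (Fin r → α) → ℝ, (∀ a φ, 0 ≤ p a φ) ∧
      (∀ φ, ∑ a, p a φ = 1) ∧ ∀ a φ, m φ * p a φ = η (Fin.cons a φ : Fin (r + 1) → α) := by
    refine ⟨fun a φ => if m φ = 0 then 1 / (Fintype.card α : ℝ)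
      else η (Fin.cons a φ : Fin (r + 1) → α) / m φ, fun a φ => ?_, fun φ => ?_, fun a φ => ?_⟩
    · dsimp only
      split_ifs
      · positivity
      · exact div_nonneg (hnn _) (hmnn φ)
    · by_cases h : m φ = 0
      · simp [h]
      · simp only [h, if_false]
        rw [← Finset.sum_div, div_self h]
    · by_cases h : m φ = 0
      · simp only [h, zero_mul]
        exact ((Finset.sum_eq_zero_iff_of_nonneg fun a _ => hnn _).1 h a (Finset.mem_univ a)).symm
      · simp only [h, if_false]
        field_simp
  induction n with
  | zero =>
    refine ⟨m, hmnn, fun g => rfl, fun β => ?_⟩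
    have : ∀ w : Fin (r + 0) → α, occ (List.ofFn w) β = 0 := fun w => by
      have h := sum_occ (r := r) (List.ofFn w)
      simp only [List.length_ofFn, Nat.add_zero, Nat.sub_self, Finset.sum_eq_zero_iff,
        Finset.mem_univ, true_implies] at h
      exact h β
    simp [this]
  | succ n ih =>
    obtain ⟨μ, hμ, hmarg, hocc⟩ := ih
    -- After prepending a letter, the first `r + 1` letters have law `η`.
    have key : ∀ h : (Fin (r + 1) → α) → ℝ,
        ∑ a, ∑ w, (μ w * p a (fun i => w (Fin.castAdd n i))) *
          h (Fin.cons a fun i => w (Fin.castAdd n i)) = ∑ β, η β * h β := by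
      intro h
      rw [sum_cons fun β => η β * h β]
      refine Finset.sum_congr rfl fun a _ => ?_
      simp only [mul_assoc]
      rw [hmarg fun φ => p a φ * h (Fin.cons a φ)]
      refine Finset.sum_congr rfl fun φ _ => ?_
      rw [← hpη, mul_assoc]
    let μ' : (Fin (r + n + 1) → α) → ℝ := fun w =>
      μ (Fin.tail w) * p (w 0) fun i => Fin.tail w (Fin.castAdd n i)
    have hind : ∀ β : Fin (r + 1) → α, _ := fun β => key fun γ => if γ = β then 1 else 0
    have hμ' : ∀ a (w : Fin (r + n) → α),
        μ' (Fin.cons a w) = μ w * p a fun i => w (Fin.castAdd n i) := fun a w => by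
      simp [μ']
    refine ⟨μ', fun w => mul_nonneg (hμ _) (hpnn _ _), fun g => ?_, fun β => ?_⟩
    · have hpre : ∀ a (w : Fin (r + n) → α),
          (fun i : Fin r => (Fin.cons a w : Fin (r + n + 1) → α) (Fin.castAdd (n + 1) i)) =
            Fin.init (Fin.cons a (fun i => w (Fin.castAdd n i)) : Fin (r + 1) → α) := by
        intro a w
        funext i
        cases r with
        | zero => exact i.elim0
        | succ r =>
          refine Fin.cases ?_ (fun j => ?_) i
          · rfl
          · rfl
      refine (sum_cons (n := r + n) _).trans ?_
      simp only [hμ', hpre]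
      rw [key fun β => g (Fin.init β), sum_snoc, Finset.sum_comm]
      refine Finset.sum_congr rfl fun φ _ => ?_
      simp only [Fin.init_snoc]
      -- Shift invariance makes the law of the first `r` letters the same after the extension.
      rw [← Finset.sum_mul, ← hsi φ]
    · refine (sum_cons (n := r + n) _).trans ?_
      have hstep : ∀ a (w : Fin (r + n) → α),
          μ' (Fin.cons a w) *
            (occ (List.ofFn (Fin.cons a w : Fin (r + n + 1) → α)) β : ℝ) =
          (μ w * occ (List.ofFn w) β) * p a (fun i => w (Fin.castAdd n i)) +
          (μ w * p a (fun i => w (Fin.castAdd n i))) *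
            (fun γ : Fin (r + 1) → α => if γ = β then (1 : ℝ) else 0)
              (Fin.cons a fun i => w (Fin.castAdd n i)) := fun a w => by
        rw [hμ', occ_ofFn_cons]
        push_cast
        ring
      refine (Finset.sum_congr rfl fun a _ => Finset.sum_congr rfl fun w _ => hstep a w).trans ?_
      simp only [Finset.sum_add_distrib]
      rw [hind, Finset.sum_comm]
      simp only [← Finset.mul_sum, hpsum, mul_one]
      rw [hocc]
      simp
      ring

end StationaryWeights

/-! ### Relative openness, and words with frequencies near `η` -/

section Neighborhoods

variable {α : Type*} [Fintype α] [DecidableEq α]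

/-- `shrink Γ ε` is a neighbourhood, within the simplex, of each of its points. Lower bounds on the
coordinates suffice because they sum to `1`. -/
lemma exists_pos_forall_mem_shrink {k : ℕ} {Γ : Set ((Fin k → α) → ℝ)} {ε : ℝ}
    {η : (Fin k → α) → ℝ} (hη : η ∈ shrink Γ ε) :
    ∃ τ > 0, ∀ y ∈ probMeasures α k, (∀ β, η β - τ ≤ y β) → y ∈ shrink Γ ε := by
  obtain ⟨hP, hε⟩ := hη
  have hopen : IsOpen {x | ENNReal.ofReal ε < Metric.infEDist x (probMeasures α k \ Γ)} :=
    isOpen_lt continuous_const Metric.continuous_infEDist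
  obtain ⟨ρ, hρ, hball⟩ := Metric.isOpen_iff.1 hopen η hε
  set K : ℝ := ((Fintype.card (Fin k → α) : ℕ) : ℝ) with hK
  have hK0 : 0 ≤ K := Nat.cast_nonneg _
  have hτ : 0 < ρ / (K + 2) := by positivity
  -- If each of the `K` coordinates drops by at most `τ`, none can rise by more than `(K - 1) * τ <
  -- ρ`.
  refine ⟨ρ / (K + 2), hτ, fun y hy hle => ⟨hy, hball ?_⟩⟩
  have hρ' : (K + 2) * (ρ / (K + 2)) = ρ := by field_simp
  set τ := ρ / (K + 2)
  rw [Metric.mem_ball, dist_pi_lt_iff hρ]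
  intro β
  have hsum : ∑ γ, (y γ - η γ + τ) = K * τ := by
    rw [Finset.sum_add_distrib, Finset.sum_sub_distrib, hy.2, hP.2]
    simp [hK]
  have hβ := Finset.single_le_sum (f := fun γ => y γ - η γ + τ)
    (fun γ _ => by linarith [hle γ]) (Finset.mem_univ β)
  rw [hsum] at hβ
  rw [Real.dist_eq, abs_lt]
  have := hle β
  constructor <;> nlinarith

/-- Words of every large length whose occurrence vectors are bounded below in terms of a given
shift-invariant measure. -/
lemma exists_word_of_shiftInvariant {r : ℕ} {η : (Fin (r + 1) → α) → ℝ}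
    (hη : η ∈ shiftInvariant α r) {τ : ℝ} (hτ : 0 < τ) :
    ∃ S : ℕ, ∀ s ≥ S, ∃ v : List α, v.length = s ∧
      ∀ β, (s : ℝ) * (η β - τ) ≤ occ v β := by
  have hne : Nonempty α := by
    by_contra h
    rw [not_nonempty_iff] at h
    simpa using hη.1.2
  -- Each block of length `r + n` has only `n` windows; this choice makes `n / (r + n) ≥ 1 - τ / 2`.
  obtain ⟨n, hn⟩ := exists_nat_gt (2 * r / τ)
  rw [div_lt_iff₀ hτ] at hn
  obtain ⟨μ, hμ, hmarg, hocc⟩ := exists_stationary_weights hη n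
  have hμ1 : ∑ w, μ w = 1 := by
    have h := hmarg fun _ => 1
    simp only [mul_one] at h
    rw [h, Finset.sum_comm, ← sum_cons, hη.1.2]
  have hn0 : 0 < n := by
    rcases Nat.eq_zero_or_pos n with rfl | h
    · simp only [Nat.cast_zero, zero_mul] at hn
      have : (0 : ℝ) ≤ 2 * r := by positivity
      linarith
    · exact h
  -- `C` bounds the loss from rounding down the number of copies of each `w`; the other `τ / 2` pays
  -- for it when `s ≥ S`.
  set C : ℝ := ∑ β : Fin (r + 1) → α, ∑ w : Fin (r + n) → α, (occ (List.ofFn w) β : ℝ)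
  obtain ⟨S, hS⟩ := exists_nat_gt (2 * C / τ)
  rw [div_lt_iff₀ hτ] at hS
  refine ⟨S, fun s hs => ?_⟩
  set L : ℝ := (r : ℝ) + n with hL
  have hn0' : (0 : ℝ) < n := by exact_mod_cast hn0
  have hL0 : 0 < L := by positivity
  let q : (Fin (r + n) → α) → ℕ := fun w => ⌊s * μ w / L⌋₊
  have hblocks : ∀ A : Finset (Fin (r + n) → α), ∃ v : List α,
      v.length = (∑ w ∈ A, q w) * (r + n) ∧
        ∀ β : Fin (r + 1) → α, ∑ w ∈ A, q w * occ (List.ofFn w) β ≤ occ v β := by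
    intro A
    induction A using Finset.induction_on with
    | empty => exact ⟨[], by simp, by simp⟩
    | insert w A hw ih =>
      obtain ⟨v, hv, hle⟩ := ih
      have hrep : ∀ j : ℕ, ∃ v : List α, v.length = j * (r + n) ∧
          ∀ β : Fin (r + 1) → α, j * occ (List.ofFn w) β ≤ occ v β := by
        intro j
        induction j with
        | zero => exact ⟨[], by simp, by simp⟩
        | succ j ih =>
          obtain ⟨v, hv, hle⟩ := ih
          refine ⟨v ++ List.ofFn w, by simp [hv, add_mul], fun β => ?_⟩
          have h1 := occ_add_le_occ_append v (List.ofFn w) β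
          have h2 := hle β
          rw [add_mul, one_mul]
          omega
      obtain ⟨u, hu, hle'⟩ := hrep (q w)
      refine ⟨u ++ v, by simp [hu, hv, Finset.sum_insert hw, add_mul], fun β => ?_⟩
      rw [Finset.sum_insert hw]
      exact (add_le_add (hle' β) (hle β)).trans (occ_add_le_occ_append u v β)
  obtain ⟨v, hv, hle⟩ := hblocks Finset.univ
  have hlen : v.length ≤ s := by
    have h1 : ((v.length : ℕ) : ℝ) ≤ s := by
      rw [hv]
      push_cast
      rw [← hL, Finset.sum_mul]
      calc ∑ w, (q w : ℝ) * L ≤ ∑ w, s * μ w := by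
            refine Finset.sum_le_sum fun w _ => ?_
            rw [← le_div_iff₀ hL0]
            exact Nat.floor_le (div_nonneg (mul_nonneg (Nat.cast_nonneg _) (hμ w)) hL0.le)
        _ = s := by rw [← Finset.mul_sum, hμ1, mul_one]
    exact_mod_cast h1
  refine ⟨v ++ List.replicate (s - v.length) (Classical.arbitrary α), by simp [hlen],
    fun β => ?_⟩
  have h1 : ((∑ w, q w * occ (List.ofFn w) β : ℕ) : ℝ) ≤
      occ (v ++ List.replicate (s - v.length) (Classical.arbitrary α)) β := by
    exact_mod_cast (hle β).trans
      ((Nat.le_add_right _ _).trans (occ_add_le_occ_append v _ β))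
  refine le_trans ?_ h1
  have h2 : s / L * (n * η β) - C ≤ ((∑ w, q w * occ (List.ofFn w) β : ℕ) : ℝ) := by
    push_cast
    have hC : ∑ w : Fin (r + n) → α, (occ (List.ofFn w) β : ℝ) ≤ C :=
      Finset.single_le_sum
        (f := fun β => ∑ w : Fin (r + n) → α, (occ (List.ofFn w) β : ℝ))
        (fun γ _ => Finset.sum_nonneg fun w _ => Nat.cast_nonneg _) (Finset.mem_univ β)
    refine (sub_le_sub_left hC _).trans ?_
    rw [← hocc, Finset.mul_sum, ← Finset.sum_sub_distrib]
    refine Finset.sum_le_sum fun w _ => ?_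
    have hfl : s * μ w / L - 1 ≤ q w := (Nat.sub_one_lt_floor _).le
    calc s / L * (μ w * occ (List.ofFn w) β) - occ (List.ofFn w) β
        = (s * μ w / L - 1) * occ (List.ofFn w) β := by ring
      _ ≤ _ := mul_le_mul_of_nonneg_right hfl (Nat.cast_nonneg _)
  refine le_trans ?_ h2
  have hη0 : 0 ≤ η β := hη.1.1 β
  have hη1 : η β ≤ 1 := by
    rw [← hη.1.2]
    exact Finset.single_le_sum (f := η) (fun γ _ => hη.1.1 γ) (Finset.mem_univ β)
  have hs0 : (0 : ℝ) ≤ s := Nat.cast_nonneg _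
  have hnL : 1 - τ / 2 ≤ n / L := by
    rw [le_div_iff₀ hL0]
    have : 0 ≤ τ * r := by positivity
    simp only [hL]
    nlinarith
  have h3 : η β - τ / 2 ≤ n / L * η β := by nlinarith
  have h4 : C ≤ s * (τ / 2) := by
    have : (S : ℝ) ≤ s := by exact_mod_cast hs
    nlinarith
  calc (s : ℝ) * (η β - τ) = s * (η β - τ / 2) - s * (τ / 2) := by ring
    _ ≤ s * (n / L * η β) - C := sub_le_sub (mul_le_mul_of_nonneg_left h3 hs0) h4
    _ = _ := by ring

end Neighborhoods

/-! ### Free monoids on words of one length -/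

section Powers

variable {α : Type*}

lemma length_of_mem_pow {W : Language α} {m : ℕ} (hW : ∀ w ∈ W, w.length = m) {t : ℕ}
    {u : List α} (hu : u ∈ W ^ t) : u.length = t * m := by
  induction t generalizing u with
  | zero => simpa using hu
  | succ t ih =>
    rw [pow_succ, Language.mem_mul] at hu
    obtain ⟨a, ha, b, hb, rfl⟩ := hu
    simp [ih ha, hW b hb, add_mul]

lemma ncard_pow {W : Language α} {m : ℕ} (hW : ∀ w ∈ W, w.length = m) (t : ℕ) :
    Set.ncard (W ^ t : Language α) = Set.ncard W ^ t := by
  induction t with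
  | zero => simp [Language.one_def]
  | succ t ih =>
    let A : Set (List α) := W ^ t
    let B : Set (List α) := W
    have himg : (W ^ (t + 1) : Language α) =
        (fun p : List α × List α => p.1 ++ p.2) '' (A ×ˢ B) := by
      ext u
      rw [pow_succ, Language.mem_mul]
      constructor
      · rintro ⟨a, ha, b, hb, rfl⟩
        exact ⟨(a, b), ⟨ha, hb⟩, rfl⟩
      · rintro ⟨⟨a, b⟩, ⟨ha, hb⟩, rfl⟩
        exact ⟨a, ha, b, hb, rfl⟩
    rw [himg, Set.InjOn.ncard_image, Set.ncard_prod, pow_succ, ← ih]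
    rintro ⟨a, b⟩ ⟨ha, hb⟩ ⟨c, d⟩ ⟨hc, hd⟩ h
    have h' := List.append_inj h (by
      simp only [length_of_mem_pow hW ha, length_of_mem_pow hW hc])
    simpa using h'

lemma wordsOfLength_kstar {W : Language α} {m : ℕ} (hm : 0 < m) (hW : ∀ w ∈ W, w.length = m)
    (t : ℕ) : wordsOfLength (KStar.kstar W) (t * m) = W ^ t := by
  ext u
  change (u ∈ KStar.kstar W ∧ u.length = t * m) ↔ u ∈ W ^ t
  rw [Language.kstar_eq_iSup_pow, Language.mem_iSup]
  constructor
  · rintro ⟨⟨j, hj⟩, hl⟩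
    rw [length_of_mem_pow hW hj] at hl
    rwa [← Nat.eq_of_mul_eq_mul_right hm hl]
  · exact fun hu => ⟨⟨t, hu⟩, length_of_mem_pow hW hu⟩

lemma wordsOfLength_kstar_of_not_dvd {W : Language α} {m n : ℕ}
    (hW : ∀ w ∈ W, w.length = m) (h : ¬ m ∣ n) :
    wordsOfLength (KStar.kstar W) n = 0 := by
  ext u
  change (u ∈ KStar.kstar W ∧ u.length = n) ↔ u ∈ (0 : Language α)
  rw [Language.kstar_eq_iSup_pow, Language.mem_iSup]
  simp only [Language.notMem_zero, iff_false, not_and, forall_exists_index]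
  intro j hj hl
  exact h ⟨j, by rw [← hl, length_of_mem_pow hW hj, mul_comm]⟩

lemma growth_eq_bot {S : Language α} {n : ℕ} (hn : 0 < n)
    (h : Set.ncard (wordsOfLength S n : Set (List α)) = 0) : growth S n = ⊥ := by
  rw [growth, h, log2, if_pos rfl]
  exact EReal.coe_mul_bot_of_pos (by positivity)

lemma growth_eq_coe {S : Language α} {n : ℕ}
    (h : Set.ncard (wordsOfLength S n : Set (List α)) ≠ 0) :
    growth S n = ((1 / (n : ℝ) *
      Real.logb 2 (Set.ncard (wordsOfLength S n : Set (List α))) : ℝ) : EReal) := by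
  rw [growth, log2, if_neg h, EReal.coe_mul]

/-- The capacity of the free monoid on a set of words of length `m`. -/
lemma capacity_kstar_wordsOfLength (S : Language α) {m : ℕ} (hm : 0 < m) :
    capacity (KStar.kstar (wordsOfLength S m)) = growth S m := by
  set W := wordsOfLength S m with hWdef
  have hW : ∀ w ∈ W, w.length = m := fun w hw => hw.2
  -- Length `0` is excluded: the growth there is `0`, since `1 / 0 = 0` and only the empty word
  -- counts.
  have hmul : ∀ t : ℕ, 0 < t → growth (KStar.kstar W) (t * m) = growth S m := by
    intro t ht
    by_cases h : Set.ncard (W : Set (List α)) = 0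
    · rw [growth_eq_bot (Nat.mul_pos ht hm), growth_eq_bot hm h]
      rw [wordsOfLength_kstar hm hW, ncard_pow hW, h, zero_pow ht.ne']
    · rw [growth_eq_coe, growth_eq_coe h, wordsOfLength_kstar hm hW, ncard_pow hW]
      · rw [← hWdef]
        rw [Nat.cast_pow, Nat.cast_mul, Real.logb_pow]
        have : (t : ℝ) ≠ 0 := by exact_mod_cast ht.ne'
        have : (m : ℝ) ≠ 0 := by exact_mod_cast hm.ne'
        congr 1
        field_simp
      · rw [wordsOfLength_kstar hm hW, ncard_pow hW]
        exact pow_ne_zero _ h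
  apply le_antisymm
  · refine limsup_le_of_le (h := ?_)
    filter_upwards [eventually_gt_atTop 0] with n hn
    by_cases h : m ∣ n
    · obtain ⟨t, rfl⟩ := h
      rw [mul_comm m t, hmul t (Nat.pos_of_mul_pos_left hn)]
    · rw [growth_eq_bot hn]
      · exact bot_le
      · rw [wordsOfLength_kstar_of_not_dvd hW h]
        exact Set.ncard_empty _
  · refine le_limsup_of_frequently_le (frequently_atTop.2 fun N => ?_)
    refine ⟨(N + 1) * m, ?_, (hmul (N + 1) N.succ_pos).ge⟩
    nlinarith

end Powers

/-! ### Correcting suffixes and convergence of the growth rates -/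

section Concatenation

variable {α : Type*} [Fintype α] [DecidableEq α] {r : ℕ} {G : Set ((Fin (r + 1) → α) → ℝ)}

omit [Fintype α] [DecidableEq α] in
/-- Concatenating `t` words of length `m` of `ℬ(G)`, `G` convex, gives at least the occurrence
vector of `t` words whose frequency vector is a point of `G`. -/
lemma exists_mem_le_occ_of_mem_pow (hconv : Convex ℝ G) (hne : G.Nonempty) {m : ℕ} {t : ℕ}
    {u : List α} (hu : u ∈ wordsOfLength (admissibleWords G) m ^ t) :
    ∃ x ∈ G, ∀ β, (t : ℝ) * ((m : ℝ) - r) * x β ≤ occ u β := by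
  induction t generalizing u with
  | zero =>
    obtain ⟨x, hx⟩ := hne
    exact ⟨x, hx, by simp⟩
  | succ t ih =>
    rw [pow_succ, Language.mem_mul] at hu
    obtain ⟨a, ha, b, ⟨⟨hk, hb⟩, hm⟩, rfl⟩ := hu
    obtain ⟨x, hx, hle⟩ := ih ha
    have ht : (0 : ℝ) < (t : ℝ) + 1 := by positivity
    -- The running mean of the block frequencies; the arbitrary starting point has weight `0` after
    -- the first block.
    refine ⟨((t : ℝ) / (t + 1)) • x + (1 / ((t : ℝ) + 1)) • freq (r + 1) b,
      hconv hx hb (by positivity) (by positivity) (by field_simp), fun β => ?_⟩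
    have hocc : (occ b β : ℝ) = ((m : ℝ) - r) * freq (r + 1) b β := by
      have hpos : (0 : ℝ) < (m : ℝ) - r := by
        have : ((r + 1 : ℕ) : ℝ) ≤ m := by exact_mod_cast hm ▸ hk
        push_cast at this
        linarith
      rw [freq_eq_occ_div, hm]
      push_cast
      have : (m : ℝ) - (r + 1) + 1 = m - r := by ring
      rw [this]
      field_simp
    have hadd : (occ a β : ℝ) + occ b β ≤ occ (a ++ b) β := by
      exact_mod_cast occ_add_le_occ_append a b β
    refine le_trans (le_of_eq ?_) ((add_le_add_left (hle β) _).trans hadd)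
    rw [hocc]
    simp only [Pi.add_apply, Pi.smul_apply, smul_eq_mul]
    push_cast
    field_simp

/-- A concatenation of words of `ℬ(G)` followed by a word with frequencies close to `η ∈ G` is in
`ℬ(G)`: its frequency vector lies on a segment from a point of `G` to a point near `η`. -/
lemma append_mem_admissibleWords (hP : G ⊆ probMeasures α (r + 1)) (hconv : Convex ℝ G)
    {η : (Fin (r + 1) → α) → ℝ} (hη : η ∈ G) {τ : ℝ} (hτ : 0 < τ)
    (hnear : ∀ y ∈ probMeasures α (r + 1), (∀ β, η β - τ ≤ y β) → y ∈ G)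
    {m t s : ℕ} (hm : r + 1 ≤ m) (hs : r + 1 ≤ s) (hts : (r : ℝ) * t ≤ τ / 2 * s)
    {u v : List α} (hu : u ∈ wordsOfLength (admissibleWords G) m ^ t) (hvs : v.length = s)
    (hv : ∀ β, (s : ℝ) * (η β - τ / 2) ≤ occ v β) :
    u ++ v ∈ admissibleWords G := by
  obtain ⟨x, hx, hxu⟩ := exists_mem_le_occ_of_mem_pow hconv ⟨η, hη⟩ hu
  have hul : u.length = t * m := length_of_mem_pow (fun w hw => hw.2) hu
  have hlen : (u ++ v).length = t * m + s := by simp [hul, hvs]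
  have hk : r + 1 ≤ (u ++ v).length := by omega
  refine ⟨hk, ?_⟩
  have hm' : (r : ℝ) + 1 ≤ m := by exact_mod_cast hm
  have hs' : (r : ℝ) + 1 ≤ s := by exact_mod_cast hs
  have ht0 : (0 : ℝ) ≤ t := Nat.cast_nonneg _
  have hr0 : (0 : ℝ) ≤ r := Nat.cast_nonneg _
  -- `A` counts the windows inside blocks, `D` the others: `s - r` in `v` and `r` across each of `t`
  -- junctions.
  set A : ℝ := t * ((m : ℝ) - r) with hA
  set D : ℝ := s - r + r * t with hD
  have hA0 : 0 ≤ A := mul_nonneg ht0 (by linarith)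
  have hD0 : 0 < D := by
    have : 0 ≤ (r : ℝ) * t := by positivity
    linarith
  have hAD : A + D = t * m + s - r := by rw [hA, hD]; ring
  have hle : ∀ β, A * x β + occ v β ≤ occ (u ++ v) β := fun β => by
    have h1 : (occ u β : ℝ) + occ v β ≤ occ (u ++ v) β := by
      exact_mod_cast occ_add_le_occ_append u v β
    linarith [hxu β]
  -- The distribution left after removing the mass `A * x`; superadditivity makes it nonnegative.
  let y : (Fin (r + 1) → α) → ℝ := fun β => (occ (u ++ v) β - A * x β) / D
  have hy0 : ∀ β, 0 ≤ y β := fun β => by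
    have : (0 : ℝ) ≤ occ v β := Nat.cast_nonneg _
    exact div_nonneg (by linarith [hle β]) hD0.le
  have hsum : ∑ β : Fin (r + 1) → α, (occ (u ++ v) β : ℝ) = A + D := by
    rw [← Nat.cast_sum, sum_occ, Nat.cast_sub (by omega), hlen, hAD]
    push_cast
    ring
  have hyP : y ∈ probMeasures α (r + 1) := by
    refine ⟨hy0, ?_⟩
    simp only [y]
    rw [← Finset.sum_div, Finset.sum_sub_distrib, ← Finset.mul_sum, hsum, (hP hx).2]
    field_simp
    ring
  have hyG : y ∈ G := by
    refine hnear y hyP fun β => ?_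
    rcases le_or_gt (η β - τ) 0 with h | h
    · exact h.trans (hy0 β)
    · have hη1 : η β ≤ 1 := by
        rw [← (hP hη).2]
        exact Finset.single_le_sum (f := η) (fun γ _ => (hP hη).1 γ) (Finset.mem_univ β)
      rw [le_div_iff₀ hD0]
      have h1 : D ≤ s + τ / 2 * s := by linarith
      have h2 : (η β - τ) * D ≤ (η β - τ) * (s + τ / 2 * s) :=
        mul_le_mul_of_nonneg_left h1 h.le
      have h3 : (η β - τ) * (τ / 2 * s) ≤ 1 * (τ / 2 * s) :=
        mul_le_mul_of_nonneg_right (by linarith) (by positivity)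
      have h4 := hv β
      have h5 := hle β
      linarith
  have hfreq : freq (r + 1) (u ++ v) = (A / (A + D)) • x + (D / (A + D)) • y := by
    funext β
    rw [freq_eq_occ_div, hlen]
    have hden : ((t * m + s : ℕ) : ℝ) - ((r + 1 : ℕ) : ℝ) + 1 = A + D := by
      rw [hAD]
      push_cast
      ring
    rw [hden]
    simp only [Pi.add_apply, Pi.smul_apply, smul_eq_mul, y]
    have : A + D ≠ 0 := by positivity
    field_simp
    ring
  rw [hfreq]
  exact hconv hx hyG (by positivity) (by positivity) (by field_simp)

omit [DecidableEq α] in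
lemma finite_wordsOfLength (S : Language α) (n : ℕ) :
    (wordsOfLength S n : Set (List α)).Finite :=
  (List.finite_length_eq α n).subset fun _ hw => hw.2

/-- The comparison of growth rates behind the existence of the limit. -/
lemma eventually_growth_ge (hP : G ⊆ probMeasures α (r + 1)) (hconv : Convex ℝ G)
    {η : (Fin (r + 1) → α) → ℝ} (hη : η ∈ G) (hsi : η ∈ shiftInvariant α r)
    {τ : ℝ} (hτ : 0 < τ)
    (hnear : ∀ y ∈ probMeasures α (r + 1), (∀ β, η β - τ ≤ y β) → y ∈ G)
    {b c : ℝ} (hbc : b < c)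
    (hfreq : ∃ᶠ m in atTop, (c : EReal) < growth (admissibleWords G) m) :
    ∀ᶠ n in atTop, (b : EReal) ≤ growth (admissibleWords G) n := by
  -- `δ` is the share of length reserved for the suffix. For `c ≤ 0` any share will do, as a
  -- nonempty set of words has nonnegative growth.
  obtain ⟨δ, hδ0, hδ1, hδ⟩ : ∃ δ : ℝ, 0 < δ ∧ δ < 1 ∧ (0 < c → b < (1 - δ) * c) := by
    rcases le_or_gt c 0 with h | h
    · exact ⟨1 / 2, by norm_num, by norm_num, fun h' => absurd h' h.not_gt⟩
    · refine ⟨min (1 / 2) ((c - b) / (2 * c)), lt_min (by norm_num)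
        (div_pos (by linarith) (by linarith)), (min_le_left _ _).trans_lt (by norm_num),
        fun _ => ?_⟩
      have h1 : min (1 / 2) ((c - b) / (2 * c)) * c ≤ (c - b) / (2 * c) * c :=
        mul_le_mul_of_nonneg_right (min_le_right _ _) h.le
      have h2 : (c - b) / (2 * c) * c = (c - b) / 2 := by field_simp
      linarith
  obtain ⟨S, hS⟩ := exists_word_of_shiftInvariant hsi (half_pos hτ)
  -- Blocks longer than `M` have so few junctions that `r * t` is at most `τ / 2` times the suffix
  -- length.
  obtain ⟨M, hM⟩ := exists_nat_gt ((r : ℝ) / (τ / 2 * δ))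
  obtain ⟨m, hmM, hcm⟩ := frequently_atTop.1 hfreq (max M (r + 1))
  have hmr : r + 1 ≤ m := (le_max_right _ _).trans hmM
  have hm0 : 0 < m := by omega
  have hm0' : (0 : ℝ) < m := by exact_mod_cast hm0
  have hrm : (r : ℝ) ≤ m * (τ / 2 * δ) := by
    rw [div_lt_iff₀ (by positivity)] at hM
    have : (M : ℝ) ≤ m := by exact_mod_cast (le_max_left _ _).trans hmM
    have : (M : ℝ) * (τ / 2 * δ) ≤ m * (τ / 2 * δ) :=
      mul_le_mul_of_nonneg_right this (by positivity)
    linarith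
  set W := wordsOfLength (admissibleWords G) m with hWdef
  have hW : ∀ w ∈ W, w.length = m := fun w hw => hw.2
  have hN0 : Set.ncard (W : Set (List α)) ≠ 0 := by
    intro h
    rw [growth_eq_bot hm0 h] at hcm
    exact not_lt_bot hcm
  set l : ℝ := Real.logb 2 (Set.ncard (W : Set (List α)) : ℝ) with hl
  have hN1 : (1 : ℝ) ≤ (Set.ncard (W : Set (List α)) : ℝ) := by
    exact_mod_cast Nat.one_le_iff_ne_zero.2 hN0
  have hl0 : 0 ≤ l := Real.logb_nonneg (by norm_num) hN1
  have hcl : c * m ≤ l := by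
    rw [growth_eq_coe hN0, EReal.coe_lt_coe_iff, ← hWdef, ← hl] at hcm
    rw [one_div, inv_mul_eq_div, lt_div_iff₀ hm0'] at hcm
    exact hcm.le
  have hcard : ∀ n : ℕ, (S : ℝ) + r + 1 ≤ δ * n → ∃ t : ℕ, (1 - δ) * n - m ≤ t * m ∧
      Set.ncard (W : Set (List α)) ^ t ≤
        Set.ncard (wordsOfLength (admissibleWords G) n : Set (List α)) := by
    intro n hn
    have hn0 : (0 : ℝ) ≤ (1 - δ) * n := mul_nonneg (by linarith) (Nat.cast_nonneg _)
    set t : ℕ := ⌊(1 - δ) * n / m⌋₊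
    have htm : (t : ℝ) * m ≤ (1 - δ) * n := by
      rw [← le_div_iff₀ hm0']
      exact Nat.floor_le (by positivity)
    have htm' : t * m ≤ n := by
      have : ((t * m : ℕ) : ℝ) ≤ n := by
        push_cast
        have : 0 ≤ δ * n := by positivity
        linarith
      exact_mod_cast this
    refine ⟨t, ?_, ?_⟩
    · have h := Nat.lt_floor_add_one ((1 - δ) * n / m)
      rw [div_lt_iff₀ hm0'] at h
      linarith
    · have hsn : δ * n ≤ ((n - t * m : ℕ) : ℝ) := by
        rw [Nat.cast_sub htm']
        push_cast
        linarith
      have hsS : S + r + 1 ≤ n - t * m := by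
        have : ((S + r + 1 : ℕ) : ℝ) ≤ ((n - t * m : ℕ) : ℝ) := by
          push_cast [-Nat.cast_sub]
          linarith
        exact_mod_cast this
      obtain ⟨v, hvl, hv⟩ := hS (n - t * m) (by omega)
      have hts : (r : ℝ) * t ≤ τ / 2 * ((n - t * m : ℕ) : ℝ) := by
        have h1 : (r : ℝ) * t ≤ m * (τ / 2 * δ) * t :=
          mul_le_mul_of_nonneg_right hrm (Nat.cast_nonneg _)
        have h2 : τ / 2 * δ * (t * m) ≤ τ / 2 * δ * n := by
          refine mul_le_mul_of_nonneg_left ?_ (by positivity)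
          exact_mod_cast htm'
        have h3 := mul_le_mul_of_nonneg_left hsn (half_pos hτ).le
        linarith
      rw [← ncard_pow hW]
      refine Set.ncard_le_ncard_of_injOn (fun u => u ++ v) (fun u hu => ⟨?_, ?_⟩) ?_
        (finite_wordsOfLength _ _)
      · exact append_mem_admissibleWords hP hconv hη hτ hnear hmr (by omega) hts hu hvl hv
      · rw [List.length_append, hvl, length_of_mem_pow hW hu]
        omega
      · intro u _ u' _ h
        simpa using h
  obtain ⟨K₁, hK₁⟩ := exists_nat_gt (((S : ℝ) + r + 1) / δ)
  -- Rounding the number of blocks costs at most `m` letters, absorbed by the gap between `(1 - δ) *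
  -- c` and `b`.
  obtain ⟨K₂, hK₂⟩ : ∃ K₂ : ℕ, 0 < c → m * c < K₂ * ((1 - δ) * c - b) := by
    rcases le_or_gt c 0 with h | h
    · exact ⟨0, fun h' => absurd h' h.not_gt⟩
    · obtain ⟨K₂, hK₂⟩ := exists_nat_gt (m * c / ((1 - δ) * c - b))
      refine ⟨K₂, fun _ => ?_⟩
      rwa [div_lt_iff₀ (by linarith [hδ h])] at hK₂
  filter_upwards [eventually_ge_atTop K₁, eventually_ge_atTop K₂, eventually_gt_atTop 0]
    with n hn₁ hn₂ hn0
  rw [div_lt_iff₀ hδ0] at hK₁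
  have hn₁' : (K₁ : ℝ) ≤ n := by exact_mod_cast hn₁
  have hn₂' : (K₂ : ℝ) ≤ n := by exact_mod_cast hn₂
  have hn0' : (0 : ℝ) < n := by exact_mod_cast hn0
  obtain ⟨t, htm, hle⟩ := hcard n (by nlinarith)
  have hne : Set.ncard (wordsOfLength (admissibleWords G) n : Set (List α)) ≠ 0 :=
    ((pow_pos (Nat.pos_of_ne_zero hN0) t).trans_le hle).ne'
  rw [growth_eq_coe hne, EReal.coe_le_coe_iff, one_div, inv_mul_eq_div, le_div_iff₀ hn0']
  have hlog : t * l ≤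
      Real.logb 2 (Set.ncard (wordsOfLength (admissibleWords G) n : Set (List α)) : ℝ) := by
    rw [hl, ← Real.logb_pow]
    refine Real.logb_le_logb_of_le (by norm_num) (by positivity) ?_
    exact_mod_cast hle
  refine le_trans ?_ hlog
  rcases le_or_gt c 0 with h | h
  · have h1 : 0 ≤ t * l := by positivity
    nlinarith
  · have h1 : (t : ℝ) * (c * m) ≤ t * l := mul_le_mul_of_nonneg_left hcl (Nat.cast_nonneg _)
    have h2 : ((1 - δ) * n - m) * c ≤ t * m * c := mul_le_mul_of_nonneg_right htm h.le
    have h3 : (K₂ : ℝ) * ((1 - δ) * c - b) ≤ n * ((1 - δ) * c - b) :=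
      mul_le_mul_of_nonneg_right hn₂' (by linarith [hδ h])
    have h4 := hK₂ h
    linarith

/-- Below the limsup, fit reals `b < c`: the growth exceeds `c` infinitely often, hence is
eventually at least `b`, so the liminf reaches the limsup. -/
lemma tendsto_growth_capacity (hP : G ⊆ probMeasures α (r + 1)) (hconv : Convex ℝ G)
    {η : (Fin (r + 1) → α) → ℝ} (hη : η ∈ G) (hsi : η ∈ shiftInvariant α r)
    {τ : ℝ} (hτ : 0 < τ)
    (hnear : ∀ y ∈ probMeasures α (r + 1), (∀ β, η β - τ ≤ y β) → y ∈ G) :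
    Tendsto (fun n => growth (admissibleWords G) n) atTop
      (𝓝 (capacity (admissibleWords G))) := by
  refine tendsto_of_le_liminf_of_limsup_le ?_ le_rfl
  refine le_of_forall_lt fun a ha => ?_
  obtain ⟨c, hac, hc⟩ := EReal.lt_iff_exists_real_btwn.1 ha
  obtain ⟨b, hab, hb⟩ := EReal.lt_iff_exists_real_btwn.1 hac
  refine hab.trans_le (le_liminf_of_le (h := ?_))
  exact eventually_growth_ge hP hconv hη hsi hτ hnear (EReal.coe_lt_coe_iff.1 hb)
    (frequently_lt_of_lt_limsup (h := hc))

end Concatenation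

end Semiconstrained

theorem mainTheorem5 {α : Type*} [Fintype α] [DecidableEq α] (r : ℕ)
    (Γ : Set ((Fin (r + 1) → α) → ℝ))
    (hΓ : Γ ⊆ Semiconstrained.probMeasures α (r + 1))
    (hclosed : IsClosed Γ) (hconvex : Convex ℝ Γ) (hfat : Semiconstrained.IsFat Γ)
    (ε : ℝ) (hε : Semiconstrained.IsAdmissible Γ ε)
    (hconvexε : Convex ℝ (Semiconstrained.shrink Γ ε)) :
    (∀ m : ℕ, 1 ≤ m →
      Semiconstrained.capacity
          (Semiconstrained.blockLanguage (Semiconstrained.shrink Γ ε) m) =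
        Semiconstrained.growth
          (Semiconstrained.admissibleWords (Semiconstrained.shrink Γ ε)) m) ∧
    Filter.Tendsto
      (fun m : ℕ => Semiconstrained.capacity
        (Semiconstrained.blockLanguage (Semiconstrained.shrink Γ ε) m))
      Filter.atTop
      (nhds (Semiconstrained.capacity
        (Semiconstrained.admissibleWords (Semiconstrained.shrink Γ ε)))) := by
  have hcap : ∀ m : ℕ, 1 ≤ m →
      Semiconstrained.capacity
          (Semiconstrained.blockLanguage (Semiconstrained.shrink Γ ε) m) =
        Semiconstrained.growth
          (Semiconstrained.admissibleWords (Semiconstrained.shrink Γ ε)) m :=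
    fun m hm => Semiconstrained.capacity_kstar_wordsOfLength _ hm
  refine ⟨hcap, ?_⟩
  obtain ⟨-, ⟨η, hη, hsi⟩, -⟩ := hε
  obtain ⟨τ, hτ, hnear⟩ := Semiconstrained.exists_pos_forall_mem_shrink hη
  refine Filter.Tendsto.congr' ?_ (Semiconstrained.tendsto_growth_capacity
    (fun x hx => hx.1) hconvexε hη hsi hτ hnear)
  filter_upwards [Filter.eventually_ge_atTop 1] with m hm
  exact (hcap m hm).symm
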